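/- For $0<p<\infty$ let $\ell^p$ be the set of all real sequences $x=(x_n)_{n\in\mathbb N}$ with $\sum_n|x_n|^p<\infty$, with the metric $d_p(x,y)=\big(\sum_n|x_n-y_n|^p\big)^{1/p}$ if $p\ge 1$ and $d_p(x,y)=\sum_n|x_n-y_n|^p$ if $p<1$. For $0\le b<\infty$ let $(p_i)_{i\in\mathbb N}$ be any sequence of reals $p_i>b$ that decreases to $b$, with $p_0<1$ if $b<1$, and give $\bigcap_{q>b}\ell^q$ the Fréchet metric \[ d_{>b}(x,y)=\sum_{i=0}^\infty 2^{-(i+1)}\,\frac{d_{p_i}(x,y)}{1+d_{p_i}(x,y)} . \] Let $\ell^\infty$ be the space of bounded real sequences with the supremum norm, and $c_0$ its subspace of sequences converging to $0$. A subset of a metrizable space $X$ is $\mathbf\Sigma^0_1$ if it is open, $\mathbf\Pi^0_n$ if its complement is $\mathbf\Sigma^0_n$, and $\mathbf\Sigma^0_{n+1}$ if it is a countable union of $\mathbf\Pi^0_n$ sets. A set $P\subseteq X$ is $\mathbf\Pi^0_n$-complete if it is a $\mathbf\Pi^0_n$ subset of $X$ and for every zero-dimensional Polish space $Z$ and every $\mathbf\Pi^0_n$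 set $A\subseteq Z$ there is a continuous $f:Z\to X$ with $A=f^{-1}[P]$. Suppose that $0\le a<b<\infty$ and let $Y$ be one of the spaces $\bigcap_{q>b}\ell^q$ (with the metric $d_{>b}$), $c_0$ or $\ell^\infty$. Then $\bigcap_{p>a}\ell^p$ is a $\mathbf\Pi^0_3$-complete subset of $Y$. In particular, $\bigcap_{p>a}\ell^p$ is neither an $F_\sigma$ nor a $G_\delta$ subset of $Y$. -/

import Mathlib

open Filter Topology
open scoped ENNReal

universe u v

/-! ### Borel hierarchy of finite order -/

/-- `IsSigmaZero n s`: the set `s` is a `Σ⁰ₙ` subset of `X` (for `n ≥ 1`; no set is `Σ⁰₀`).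
`Σ⁰₁` sets are the open sets, and `Σ⁰ₙ₊₁` sets are the countable unions of `Π⁰ₙ` sets, where
a `Π⁰ₙ` set is the complement of a `Σ⁰ₙ` set. -/
def IsSigmaZero {X : Type u} [TopologicalSpace X] : ℕ → Set X → Prop
  | 0, _ => False
  | 1, s => IsOpen s
  | n + 2, s => ∃ f : ℕ → Set X, (∀ i, IsSigmaZero (n + 1) (f i)ᶜ) ∧ s = ⋃ i, f i

/-- `IsPiZero n s`: the set `s` is a `Π⁰ₙ` subset of `X`. -/
def IsPiZero {X : Type u} [TopologicalSpace X] (n : ℕ) (s : Set X) : Prop :=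
  IsSigmaZero n sᶜ

/-- `F_σ` sets: countable unions of closed sets. (Mathlib has `IsGδ`.) -/
def IsFSigma {X : Type u} [TopologicalSpace X] (s : Set X) : Prop :=
  ∃ F : ℕ → Set X, (∀ i, IsClosed (F i)) ∧ s = ⋃ i, F i

/-- Zero-dimensional: the clopen sets form a basis of the topology. -/
def IsZeroDimensional (Z : Type u) [TopologicalSpace Z] : Prop :=
  TopologicalSpace.IsTopologicalBasis {s : Set Z | IsClopen s}

/-- `P` is `Π⁰ₙ`-complete: it is `Π⁰ₙ`, and every `Π⁰ₙ` subset of every zero-dimensional Polish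
space is the preimage of `P` under a continuous function. -/
def IsPiZeroComplete {X : Type u} [TopologicalSpace X] (n : ℕ) (P : Set X) : Prop :=
  IsPiZero n P ∧
    ∀ (Z : Type v) [TopologicalSpace Z] [PolishSpace Z], IsZeroDimensional Z →
      ∀ A : Set Z, IsPiZero n A → ∃ f : Z → X, Continuous f ∧ A = f ⁻¹' P

/-! ### The sequence spaces -/

/-- The set of real sequences `⋂_{p > a} ℓ^p` (used for `a ≥ 0`). -/
def interEll (a : ℝ) : Set (ℕ → ℝ) :=
  {x | ∀ p : ℝ, a < p → Memℓp x (ENNReal.ofReal p)}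

/-- The standard metric of `ℓ^p`: the norm distance `(∑ |xₙ - yₙ|^p)^(1/p)` if `p ≥ 1`, and
`∑ |xₙ - yₙ|^p` if `0 < p < 1`. -/
noncomputable def ellDist (p : ℝ) (x y : ℕ → ℝ) : ℝ :=
  if 1 ≤ p then (∑' n, |x n - y n| ^ p) ^ (1 / p) else ∑' n, |x n - y n| ^ p

/-- A sequence of positive exponents, all larger than `b`, that decreases to `b`, with all its
terms below `1` if `b < 1`. -/
structure ExponentSeq (b : ℝ) where
  /-- the exponents -/
  exp : ℕ → ℝ
  pos : ∀ i, 0 < exp i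
  gt : ∀ i, b < exp i
  anti : Antitone exp
  tendsto : Tendsto exp atTop (𝓝 b)
  lt_one : b < 1 → exp 0 < 1

/-- The space `⋂_{q > b} ℓ^q`, to be metrized by means of the exponents `P`. (A structure, so that
it does not inherit the product topology of `ℕ → ℝ`.) -/
@[ext] structure InterEll {b : ℝ} (P : ExponentSeq b) where
  /-- the underlying sequence -/
  val : ℕ → ℝ
  mem : val ∈ interEll b

theorem summable_of_mem_interEll {b p : ℝ} (hp : 0 < p) (hbp : b < p) {x y : ℕ → ℝ}
    (hx : x ∈ interEll b) (hy : y ∈ interEll b) : Summable fun n => |x n - y n| ^ p := by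
  have h := (hx p hbp).sub (hy p hbp)
  have hp' : 0 < (ENNReal.ofReal p).toReal := by rwa [ENNReal.toReal_ofReal hp.le]
  have h2 := (memℓp_gen_iff hp').1 h
  rw [ENNReal.toReal_ofReal hp.le] at h2
  simpa [Real.norm_eq_abs] using h2

theorem ellDist_nonneg (p : ℝ) (x y : ℕ → ℝ) : 0 ≤ ellDist p x y := by
  have h : 0 ≤ ∑' n, |x n - y n| ^ p := tsum_nonneg fun n => by positivity
  unfold ellDist
  split_ifs
  · exact Real.rpow_nonneg h _
  · exact h

theorem ellDist_self {p : ℝ} (hp : 0 < p) (x : ℕ → ℝ) : ellDist p x x = 0 := by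
  have h : p⁻¹ ≠ 0 := inv_ne_zero hp.ne'
  simp [ellDist, Real.zero_rpow hp.ne', Real.zero_rpow h]

theorem ellDist_comm (p : ℝ) (x y : ℕ → ℝ) : ellDist p x y = ellDist p y x := by
  simp only [ellDist, abs_sub_comm]

theorem eq_of_ellDist_eq_zero {b p : ℝ} (hp : 0 < p) (hbp : b < p) {x y : ℕ → ℝ}
    (hx : x ∈ interEll b) (hy : y ∈ interEll b) (h : ellDist p x y = 0) : x = y := by
  have hs := summable_of_mem_interEll hp hbp hx hy
  have h0 : ∑' n, |x n - y n| ^ p = 0 := by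
    unfold ellDist at h
    split_ifs at h
    · exact ((Real.rpow_eq_zero_iff_of_nonneg (tsum_nonneg fun n => by positivity)).1 h).1
    · exact h
  have h1 := (hasSum_zero_iff_of_nonneg (fun n => by positivity)).1 (h0 ▸ hs.hasSum)
  funext n
  have h2 : |x n - y n| ^ p = 0 := congrFun h1 n
  have h3 := ((Real.rpow_eq_zero_iff_of_nonneg (abs_nonneg _)).1 h2).1
  exact sub_eq_zero.1 (abs_eq_zero.1 h3)

theorem ellDist_triangle {b p : ℝ} (hp : 0 < p) (hbp : b < p) {x y z : ℕ → ℝ}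
    (hx : x ∈ interEll b) (hy : y ∈ interEll b) (hz : z ∈ interEll b) :
    ellDist p x z ≤ ellDist p x y + ellDist p y z := by
  have hxy := summable_of_mem_interEll hp hbp hx hy
  have hyz := summable_of_mem_interEll hp hbp hy hz
  have hxz := summable_of_mem_interEll hp hbp hx hz
  have hpt : ∀ n, |x n - z n| ^ p ≤ (|x n - y n| + |y n - z n|) ^ p := fun n =>
    Real.rpow_le_rpow (abs_nonneg _) (abs_sub_le _ _ _) hp.le
  unfold ellDist
  split_ifs with h1
  · have hM := Real.Lp_add_le_tsum_of_nonneg h1 (fun n => abs_nonneg (x n - y n))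
      (fun n => abs_nonneg (y n - z n)) hxy hyz
    refine le_trans ?_ hM.2
    exact Real.rpow_le_rpow (tsum_nonneg fun n => by positivity)
      (hxz.tsum_le_tsum hpt hM.1) (by positivity)
  · rw [← hxy.tsum_add hyz]
    refine hxz.tsum_le_tsum (fun n => (hpt n).trans ?_) (hxy.add hyz)
    exact Real.rpow_add_le_add_rpow (abs_nonneg _) (abs_nonneg _) hp.le (not_le.1 h1).le

/-- The metric `∑ᵢ 2^{-(i+1)} dᵢ(x,y) / (1 + dᵢ(x,y))` of `⋂_{q > b} ℓ^q`, where `dᵢ` is the metric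
of `ℓ^{pᵢ}`. -/
noncomputable def interEllDist {b : ℝ} (P : ExponentSeq b) (x y : ℕ → ℝ) : ℝ :=
  ∑' i : ℕ, (1 / 2 : ℝ) ^ (i + 1) *
    (ellDist (P.exp i) x y / (1 + ellDist (P.exp i) x y))

theorem summable_interEllDist {b : ℝ} (P : ExponentSeq b) (x y : ℕ → ℝ) :
    Summable fun i : ℕ => (1 / 2 : ℝ) ^ (i + 1) *
      (ellDist (P.exp i) x y / (1 + ellDist (P.exp i) x y)) := by
  have hg : Summable fun i : ℕ => (1 / 2 : ℝ) ^ (i + 1) :=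
    (summable_nat_add_iff 1).2 summable_geometric_two
  refine Summable.of_nonneg_of_le (fun i => ?_) (fun i => ?_) hg
  · have := ellDist_nonneg (P.exp i) x y
    positivity
  · have := ellDist_nonneg (P.exp i) x y
    refine mul_le_of_le_one_right (by positivity) ?_
    rw [div_le_one (by positivity)]
    linarith

theorem div_one_add_triangle {r s t : ℝ} (hr : 0 ≤ r) (hs : 0 ≤ s) (ht : 0 ≤ t)
    (h : r ≤ s + t) : r / (1 + r) ≤ s / (1 + s) + t / (1 + t) := by
  rw [div_add_div _ _ (by positivity) (by positivity), div_le_div_iff₀ (by positivity)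
    (by positivity)]
  nlinarith [mul_nonneg hr hs, mul_nonneg hr ht, mul_nonneg hs ht,
    mul_nonneg (mul_nonneg hr hs) ht]

noncomputable instance {b : ℝ} (P : ExponentSeq b) : MetricSpace (InterEll P) where
  dist x y := interEllDist P x.val y.val
  dist_self x := by simp [interEllDist, ellDist_self (P.pos _)]
  dist_comm x y := by simp only [interEllDist, ellDist_comm]
  dist_triangle x y z := by
    rw [interEllDist, interEllDist, interEllDist,
      ← (summable_interEllDist P x.val y.val).tsum_add (summable_interEllDist P y.val z.val)]
    refine (summable_interEllDist P x.val z.val).tsum_le_tsum (fun i => ?_)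
      ((summable_interEllDist P x.val y.val).add (summable_interEllDist P y.val z.val))
    rw [← mul_add]
    exact mul_le_mul_of_nonneg_left
      (div_one_add_triangle (ellDist_nonneg _ _ _) (ellDist_nonneg _ _ _) (ellDist_nonneg _ _ _)
        (ellDist_triangle (P.pos i) (P.gt i) x.mem y.mem z.mem)) (by positivity)
  eq_of_dist_eq_zero := by
    intro x y h
    have hn : ∀ i : ℕ, 0 ≤ (1 / 2 : ℝ) ^ (i + 1) *
        (ellDist (P.exp i) x.val y.val / (1 + ellDist (P.exp i) x.val y.val)) := fun i => by
      have := ellDist_nonneg (P.exp i) x.val y.val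
      positivity
    have hs := (summable_interEllDist P x.val y.val).hasSum
    have h' : interEllDist P x.val y.val = 0 := h
    rw [interEllDist] at h'
    rw [h'] at hs
    have h0 := congrFun ((hasSum_zero_iff_of_nonneg hn).1 hs) 0
    have hd := ellDist_nonneg (P.exp 0) x.val y.val
    have h1 : ellDist (P.exp 0) x.val y.val = 0 := by
      have h2 := (mul_eq_zero.1 h0).resolve_left (by positivity)
      exact (div_eq_zero_iff.1 h2).resolve_right (by positivity)
    exact InterEll.ext (eq_of_ellDist_eq_zero (P.pos 0) (P.gt 0) x.mem y.mem h1)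

/-- The space `ℓ^∞` of bounded real sequences, with the supremum norm. -/
abbrev EllInfty : Type := lp (fun _ : ℕ => ℝ) ∞

/-- The space `c₀` of real sequences that converge to `0`, with the metric inherited from `ℓ^∞`. -/
abbrev CZero : Type := {x : EllInfty // Tendsto (fun n => x n) atTop (𝓝 0)}

/-! ### Clopen families detecting `Σ⁰₂` and `Π⁰₃` sets -/

section ZeroDimensional

variable {Z : Type u} [TopologicalSpace Z] [SecondCountableTopology Z]

/-! In a zero-dimensional second countable space, a `Π⁰₃` condition on z says that for every k only
finitely many n satisfy z ∈ V k n, with all V k n clopen. Hardness thus means encoding such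
conditions continuously (`ReducesFiniteness`).

Let exponents r k decrease strictly from r 0 = b to a. To each pair (k, m) attach a block of N equal
terms w with N w^r(k+1) = 1 but N w^r(k) ≤ ε(k, m), where ε is summable (`exists_block`), and switch
the block on exactly when z ∈ V k m. At exponent r (k+1) every active block of row k contributes 1,
so infinitely many of them destroy membership. If every row has finitely many active blocks and p >
a, the rows with r k ≤ p are dominated by ε, and the others contribute finitely many terms
(`exists_blockWeights`). For q ≥ b all blocks are dominated by ε, so dominated convergence makes the
encoding continuous in `ℓ^q`, hence in each space Y.

The upper bound holds because bounding all partial sums is a closed condition. Failure of `F_σ` and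
`G_δ` follows by pulling back to Cantor space and applying Baire's theorem. -/

theorem IsZeroDimensional.exists_disjoint_isClopen (hZ : IsZeroDimensional Z) {U : Set Z}
    (hU : IsOpen U) : ∃ V : ℕ → Set Z,
      (∀ n, IsClopen (V n)) ∧ Pairwise (Function.onFun Disjoint V) ∧ ⋃ n, V n = U := by
  obtain ⟨B, hBs, hBc, hB⟩ := TopologicalSpace.IsTopologicalBasis.exists_countable hZ
  -- Inserting the empty set makes the family nonempty, so that it can be enumerated by `ℕ`.
  obtain ⟨f, hf⟩ := ((hBc.mono (Set.sep_subset B fun s => s ⊆ U)).insert ∅).exists_eq_range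
    (Set.insert_nonempty _ _)
  have hmem : ∀ n, f n ∈ insert ∅ {s ∈ B | s ⊆ U} := fun n => hf ▸ Set.mem_range_self n
  have hclopen : ∀ n, IsClopen (f n) := fun n => by
    rcases hmem n with h | h
    · rw [h]; exact isClopen_empty
    · exact hBs h.1
  refine ⟨disjointed f, fun n => ?_, disjoint_disjointed f, ?_⟩
  · exact disjointedRec (fun _ i h => h.diff (hclopen i)) (hclopen n)
  · rw [iUnion_disjointed]
    ext z
    rw [Set.mem_iUnion]
    constructor
    · rintro ⟨n, hn⟩
      rcases hmem n with h | h
      · rw [h] at hn; exact hn.elim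
      · exact h.2 hn
    · intro hz
      obtain ⟨s, hs, hzs, hsU⟩ := hB.exists_subset_of_mem_open hz hU
      have : s ∈ Set.range f := hf ▸ Or.inr ⟨hs, hsU⟩
      obtain ⟨n, rfl⟩ := this
      exact ⟨n, hzs⟩

/-- A countable union of closed sets is the set of points that lie in only finitely many members
of some sequence of clopen sets. -/
theorem IsZeroDimensional.exists_isClopen_finite_iff (hZ : IsZeroDimensional Z)
    {F : ℕ → Set Z} (hF : ∀ i, IsClosed (F i)) : ∃ V : ℕ → Set Z,
      (∀ n, IsClopen (V n)) ∧ ∀ z, z ∈ ⋃ i, F i ↔ {n | z ∈ V n}.Finite := by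
  have hU : ∀ m : ℕ, IsOpen (⋃ i ∈ Set.Iic m, F i)ᶜ := fun m =>
    ((Set.finite_Iic m).isClosed_biUnion fun i _ => hF i).isOpen_compl
  -- At each level m the point z lies in at most one piece, and in one exactly when none of F 0, …,
  -- F m contains z. So the pieces containing z are finite in number iff some F i contains z.
  choose V hV hVd hVU using fun m => hZ.exists_disjoint_isClopen (hU m)
  refine ⟨fun n => V n.unpair.1 n.unpair.2, fun n => hV _ _, fun z => ⟨fun hz => ?_, fun h => ?_⟩⟩
  · obtain ⟨i, hi⟩ := Set.mem_iUnion.1 hz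
    refine Set.Finite.of_finite_image (f := fun n => n.unpair.1)
      ((Set.finite_Iio i).subset ?_) ?_
    · rintro _ ⟨n, hn, rfl⟩
      have h1 : z ∈ (⋃ i ∈ Set.Iic n.unpair.1, F i)ᶜ := hVU n.unpair.1 ▸ Set.mem_iUnion.2 ⟨_, hn⟩
      by_contra hlt
      exact h1 (Set.mem_biUnion (Set.mem_Iic.2 (not_lt.1 hlt)) hi)
    · intro n hn n' hn' hnn
      have hn1 : z ∈ V n.unpair.1 n.unpair.2 := hn
      have hn2 : z ∈ V n'.unpair.1 n'.unpair.2 := hn'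
      have hnn1 : n.unpair.1 = n'.unpair.1 := hnn
      rw [← hnn1] at hn2
      have h2 : n.unpair.2 = n'.unpair.2 := by
        by_contra hne
        exact Set.disjoint_left.1 (hVd n.unpair.1 hne) hn1 hn2
      rw [← Nat.pair_unpair n, ← Nat.pair_unpair n', hnn1, h2]
  · by_contra hz
    have h1 : ∀ m, ∃ j, z ∈ V m j := fun m => by
      have : z ∈ ⋃ j, V m j := by
        rw [hVU m]
        intro hz'
        obtain ⟨i, -, hi⟩ := Set.mem_iUnion₂.1 hz'
        exact hz (Set.mem_iUnion.2 ⟨i, hi⟩)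
      exact Set.mem_iUnion.1 this
    choose j hj using h1
    refine Set.infinite_of_injective_forall_mem (f := fun m => Nat.pair m (j m)) ?_ ?_ h
    · intro m m' hm
      exact (Nat.pair_eq_pair.1 hm).1
    · intro m
      simpa using hj m

theorem isSigmaZero_two_iff {X : Type u} [TopologicalSpace X] {s : Set X} :
    IsSigmaZero 2 s ↔ ∃ F : ℕ → Set X, (∀ i, IsClosed (F i)) ∧ s = ⋃ i, F i := by
  simp only [IsSigmaZero, isOpen_compl_iff]

theorem isPiZero_three_iff {X : Type u} [TopologicalSpace X] {s : Set X} :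
    IsPiZero 3 s ↔ ∃ F : ℕ → ℕ → Set X, (∀ k i, IsClosed (F k i)) ∧ s = ⋂ k, ⋃ i, F k i := by
  have h : IsPiZero 3 s ↔ ∃ f : ℕ → Set X, (∀ k, IsSigmaZero 2 (f k)ᶜ) ∧ sᶜ = ⋃ k, f k := Iff.rfl
  simp only [h, isSigmaZero_two_iff]
  constructor
  · rintro ⟨f, hf, hs⟩
    choose F hF hFf using hf
    refine ⟨F, hF, ?_⟩
    simp only [← hFf]
    rw [← Set.compl_iUnion, ← hs, compl_compl]
  · rintro ⟨F, hF, rfl⟩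
    exact ⟨fun k => (⋃ i, F k i)ᶜ, fun k => ⟨F k, hF k, compl_compl _⟩, by rw [Set.compl_iInter]⟩

theorem IsPiZero.exists_isClopen_finite_iff (hZ : IsZeroDimensional Z) {A : Set Z}
    (hA : IsPiZero 3 A) : ∃ V : ℕ → ℕ → Set Z,
      (∀ k n, IsClopen (V k n)) ∧ ∀ z, z ∈ A ↔ ∀ k, {n | z ∈ V k n}.Finite := by
  obtain ⟨F, hF, rfl⟩ := isPiZero_three_iff.1 hA
  choose V hV hVF using fun k => hZ.exists_isClopen_finite_iff (hF k)
  exact ⟨V, hV, fun z => by simp only [Set.mem_iInter, hVF]⟩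

end ZeroDimensional

/-! ### A criterion for completeness -/

/-- Every set that is defined by the finiteness of countably many sequences of clopen conditions
is a continuous preimage of `P`. -/
def ReducesFiniteness {X : Type u} [TopologicalSpace X] (P : Set X) : Prop :=
  ∀ (Z : Type v) [TopologicalSpace Z] (V : ℕ → ℕ → Set Z), (∀ k n, IsClopen (V k n)) →
    ∃ f : Z → X, Continuous f ∧ ∀ z, f z ∈ P ↔ ∀ k, {n | z ∈ V k n}.Finite

section Criterion

variable {X : Type u} [TopologicalSpace X] {P : Set X}

theorem ReducesFiniteness.isPiZeroComplete (h : ReducesFiniteness.{u, v} P) (hP : IsPiZero 3 P) :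
    IsPiZeroComplete.{u, v} 3 P := by
  refine ⟨hP, fun Z _ _ hZ A hA => ?_⟩
  obtain ⟨V, hV, hVA⟩ := IsPiZero.exists_isClopen_finite_iff hZ hA
  obtain ⟨f, hf, hfP⟩ := h Z V hV
  exact ⟨f, hf, Set.ext fun z => (hVA z).trans (hfP z).symm⟩

theorem dense_setOf_finite_ne (b : Bool) : Dense {x : ℕ → Bool | {n | x n ≠ b}.Finite} := by
  intro x
  have h : Tendsto (fun (n : ℕ) (i : ℕ) => if i < n then x i else b) atTop (𝓝 x) := by
    rw [tendsto_pi_nhds]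
    intro i
    refine tendsto_const_nhds.congr' ?_
    filter_upwards [eventually_gt_atTop i] with n hn
    rw [if_pos hn]
  refine mem_closure_of_tendsto h (Eventually.of_forall fun n => ?_)
  refine (Set.finite_Iio n).subset fun i hi => ?_
  by_contra hin
  exact hi (if_neg hin)

theorem countable_setOf_finite_eq_true : {x : ℕ → Bool | {n | x n = true}.Finite}.Countable := by
  refine (Set.countable_range fun (s : Finset ℕ) (i : ℕ) => decide (i ∈ s)).mono ?_
  intro x hx
  refine ⟨hx.toFinset, funext fun i => ?_⟩
  simp

theorem isGδ_setOf_infinite_eq_true : IsGδ {x : ℕ → Bool | {n | x n = true}.Infinite} :=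
  countable_setOf_finite_eq_true.isGδ_compl

/-- Otherwise this set and its complement would be disjoint dense `G_δ` sets, against Baire's
theorem. -/
theorem not_isGδ_setOf_finite_eq_true : ¬ IsGδ {x : ℕ → Bool | {n | x n = true}.Finite} := by
  intro h
  have h1 : Dense {x : ℕ → Bool | {n | x n = true}.Finite} := by
    simpa using dense_setOf_finite_ne false
  have h2 : Dense {x : ℕ → Bool | {n | x n = true}.Infinite} := by
    refine (dense_setOf_finite_ne true).mono fun x hx => ?_
    have := hx.infinite_compl
    simpa [Set.compl_ofPred] using this
  obtain ⟨x, hx, hx'⟩ := (h1.inter_of_Gδ h isGδ_setOf_infinite_eq_true h2).nonempty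
  exact hx' hx

theorem isClopen_setOf_apply_eq (n : ℕ) (b : Bool) : IsClopen {x : ℕ → Bool | x n = b} :=
  (isClopen_discrete {b}).preimage (continuous_apply n)

theorem ReducesFiniteness.not_isGδ (h : ReducesFiniteness.{u, 0} P) : ¬ IsGδ P := by
  intro hP
  obtain ⟨f, hf, hfP⟩ := h (ℕ → Bool) (fun _ n => {x | x n = true})
    fun _ n => isClopen_setOf_apply_eq n true
  have h1 : f ⁻¹' P = {x : ℕ → Bool | {n | x n = true}.Finite} := by
    ext x
    simp [hfP]
  exact not_isGδ_setOf_finite_eq_true (h1 ▸ hP.preimage hf)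

theorem ReducesFiniteness.not_isFSigma (h : ReducesFiniteness.{u, 0} P) : ¬ IsFSigma P := by
  rintro ⟨F, hF, rfl⟩
  -- Row k is infinite iff x is false from k on; the indices n < k give the whole space, which is
  -- harmless. Hence f x lies outside the set iff x is true only finitely often.
  obtain ⟨f, hf, hfP⟩ := h (ℕ → Bool) (fun k n => ⋂ i ∈ Set.Icc k n, {x | x i = false})
    fun k n => (Set.finite_Icc k n).isClopen_biInter fun i _ => isClopen_setOf_apply_eq i false
  have h1 : f ⁻¹' (⋃ i, F i)ᶜ = {x : ℕ → Bool | {n | x n = true}.Finite} := by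
    ext x
    rw [Set.mem_preimage, Set.mem_compl_iff, hfP, Set.mem_ofPred_eq, ← not_iff_not, not_not]
    change _ ↔ {n | x n = true}.Infinite
    constructor
    · refine fun hx => Set.infinite_of_forall_exists_gt fun k => ?_
      by_contra! hk
      refine (hx (k + 1)).not_infinite (Set.infinite_univ.mono fun n _ => ?_)
      simp only [Set.mem_ofPred_eq, Set.mem_iInter, Set.mem_Icc]
      intro i hi
      by_contra hne
      have := hk i (by simpa using hne)
      omega
    · intro hx k
      obtain ⟨i, hi, hki⟩ := hx.exists_gt k
      refine (Set.finite_Iio i).subset fun n hn => ?_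
      simp only [Set.mem_ofPred_eq, Set.mem_iInter, Set.mem_Icc] at hn hi
      by_contra hni
      have := hn i ⟨hki.le, not_lt.1 hni⟩
      simp [hi] at this
  have h2 : IsGδ (⋃ i, F i)ᶜ := by
    rw [Set.compl_iUnion]
    exact .iInter fun i => (hF i).isOpen_compl.isGδ
  exact not_isGδ_setOf_finite_eq_true (h1 ▸ h2.preimage hf)

end Criterion

/-! ### The set `⋂_{p > a} ℓ^p` is `Π⁰₃` -/

theorem mem_interEll_iff {a : ℝ} (ha : 0 ≤ a) {x : ℕ → ℝ} :
    x ∈ interEll a ↔ ∀ p, a < p → Summable fun n => |x n| ^ p := by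
  refine forall₂_congr fun p hp => ?_
  have hp0 : 0 ≤ p := ha.trans hp.le
  rw [memℓp_gen_iff (by rw [ENNReal.toReal_ofReal hp0]; exact ha.trans_lt hp),
    ENNReal.toReal_ofReal hp0]
  simp only [Real.norm_eq_abs]

/-- Since `ℓ^p` grows with p, countably many exponents tending to a suffice. -/
theorem mem_interEll_iff_nat {a : ℝ} (ha : 0 ≤ a) {x : ℕ → ℝ} :
    x ∈ interEll a ↔ ∀ k : ℕ, Summable fun n => |x n| ^ (a + 1 / ((k : ℝ) + 1)) := by
  rw [mem_interEll_iff ha]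
  refine ⟨fun h k => h _ (lt_add_of_pos_right _ (by positivity)), fun h p hp => ?_⟩
  obtain ⟨k, hk⟩ := exists_nat_one_div_lt (sub_pos.2 hp)
  have hpos : 0 < a + 1 / ((k : ℝ) + 1) := by positivity
  have hk' : a + 1 / ((k : ℝ) + 1) ≤ p := by linarith
  have hx : Memℓp x (ENNReal.ofReal (a + 1 / ((k : ℝ) + 1))) := by
    rw [memℓp_gen_iff (by rwa [ENNReal.toReal_ofReal hpos.le]), ENNReal.toReal_ofReal hpos.le]
    simpa only [Real.norm_eq_abs] using h k
  have hx' := hx.of_exponent_ge (ENNReal.ofReal_le_ofReal hk')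
  rw [memℓp_gen_iff (by rw [ENNReal.toReal_ofReal (hpos.le.trans hk')]; linarith),
    ENNReal.toReal_ofReal (hpos.le.trans hk')] at hx'
  simpa only [Real.norm_eq_abs] using hx'

theorem isPiZero_three_preimage_interEll {X : Type u} [TopologicalSpace X] {a : ℝ} (ha : 0 ≤ a)
    {φ : X → ℕ → ℝ} (hφ : ∀ n, Continuous fun x => φ x n) :
    IsPiZero 3 {x | φ x ∈ interEll a} := by
  refine isPiZero_three_iff.2 ⟨fun k M =>
    {x | ∀ N : ℕ, ∑ n ∈ Finset.range N, |φ x n| ^ (a + 1 / ((k : ℝ) + 1)) ≤ M}, fun k M => ?_, ?_⟩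
  · have hpos : 0 < a + 1 / ((k : ℝ) + 1) := by positivity
    dsimp only
    rw [Set.ofPred_forall]
    refine isClosed_iInter fun N => isClosed_le ?_ continuous_const
    exact continuous_finsetSum _ fun n _ => (hφ n).abs.rpow_const fun _ => Or.inr hpos.le
  · ext x
    simp only [Set.mem_ofPred_eq, mem_interEll_iff_nat ha, Set.mem_iInter, Set.mem_iUnion]
    refine forall_congr' fun k => ⟨fun h => ?_, fun ⟨M, hM⟩ => ?_⟩
    · obtain ⟨M, hM⟩ := exists_nat_ge (∑' n, |φ x n| ^ (a + 1 / ((k : ℝ) + 1)))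
      exact ⟨M, fun N => (h.sum_le_tsum _ fun n _ => by positivity).trans hM⟩
    · exact summable_of_sum_range_le (fun n => by positivity) hM

/-! ### Convergence in `⋂_{q > b} ℓ^q` -/

/-- A single positive power covers both cases of the metric, so continuity of powers at 0 applies
uniformly. -/
theorem ellDist_eq_rpow (p : ℝ) (x y : ℕ → ℝ) :
    ellDist p x y = (∑' n, |x n - y n| ^ p) ^ (if 1 ≤ p then 1 / p else 1) := by
  unfold ellDist
  split_ifs
  · rfl
  · rw [Real.rpow_one]

theorem abs_sub_le_tsum_rpow {q : ℝ} (hq : 0 < q) {x y : ℕ → ℝ}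
    (h : Summable fun n => |x n - y n| ^ q) (n : ℕ) :
    |x n - y n| ≤ (∑' n, |x n - y n| ^ q) ^ (1 / q) := by
  have h1 : |x n - y n| ^ q ≤ ∑' n, |x n - y n| ^ q :=
    h.le_tsum n fun m _ => by positivity
  calc |x n - y n| = (|x n - y n| ^ q) ^ (1 / q) := by
        rw [← Real.rpow_mul (abs_nonneg _), mul_one_div_cancel hq.ne', Real.rpow_one]
    _ ≤ _ := Real.rpow_le_rpow (by positivity) h1 (by positivity)

theorem abs_sub_le_ellDist_rpow {q : ℝ} (hq : 0 < q) {x y : ℕ → ℝ}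
    (h : Summable fun n => |x n - y n| ^ q) (n : ℕ) :
    |x n - y n| ≤ ellDist q x y ^ (if 1 ≤ q then 1 else 1 / q) := by
  refine (abs_sub_le_tsum_rpow hq h n).trans_eq ?_
  unfold ellDist
  split_ifs
  · rw [Real.rpow_one]
  · rfl

namespace InterEll

variable {b : ℝ} {P : ExponentSeq b}

theorem dist_eq (x y : InterEll P) : dist x y = ∑' i : ℕ, (1 / 2 : ℝ) ^ (i + 1) *
    (ellDist (P.exp i) x.val y.val / (1 + ellDist (P.exp i) x.val y.val)) := rfl

theorem tendsto_of_tendsto_ellDist {α : Type v} {l : Filter α} {f : α → InterEll P}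
    {x : InterEll P} (h : ∀ i, Tendsto (fun t => ellDist (P.exp i) (f t).val x.val) l (𝓝 0)) :
    Tendsto f l (𝓝 x) := by
  rw [tendsto_iff_dist_tendsto_zero]
  simp only [dist_eq]
  have hg : Summable fun i : ℕ => (1 / 2 : ℝ) ^ (i + 1) :=
    (summable_nat_add_iff 1).2 summable_geometric_two
  suffices h0 : Tendsto _ l (𝓝 (∑' _ : ℕ, (0 : ℝ))) by rwa [tsum_zero] at h0
  refine tendsto_tsum_of_dominated_convergence hg (fun i => ?_)
    (Eventually.of_forall fun t i => ?_)
  · have h1 := ((h i).div ((h i).const_add 1) (by norm_num)).const_mul ((1 / 2 : ℝ) ^ (i + 1))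
    simpa using h1
  · have h0 := ellDist_nonneg (P.exp i) (f t).val x.val
    rw [Real.norm_of_nonneg (by positivity)]
    refine mul_le_of_le_one_right (by positivity) ?_
    rw [div_le_one (by positivity)]
    linarith

theorem tendsto_ellDist_zero (x : InterEll P) :
    Tendsto (fun y : InterEll P => ellDist (P.exp 0) y.val x.val) (𝓝 x) (𝓝 0) := by
  set r : InterEll P → ℝ := fun y =>
    ellDist (P.exp 0) y.val x.val / (1 + ellDist (P.exp 0) y.val x.val) with hr
  have hr0 : Tendsto r (𝓝 x) (𝓝 0) := by
    -- The term i = 0 of the metric has weight 1/2, whence the factor 2.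
    have hd : Tendsto (fun y : InterEll P => 2 * dist y x) (𝓝 x) (𝓝 0) := by
      simpa using
        (tendsto_iff_dist_tendsto_zero.1 (tendsto_id (α := InterEll P) (x := 𝓝 x))).const_mul 2
    refine squeeze_zero (fun y => ?_) (fun y => ?_) hd
    · have := ellDist_nonneg (P.exp 0) y.val x.val
      positivity
    · have h1 := (summable_interEllDist P y.val x.val).le_tsum 0 fun i _ => by
        have := ellDist_nonneg (P.exp i) y.val x.val
        positivity
      rw [← dist_eq] at h1
      norm_num at h1
      simp only [hr]
      linarith
  -- The map d ↦ d / (1 + d) is inverted by r ↦ r / (1 - r).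
  have h1 : Tendsto (fun y => r y / (1 - r y)) (𝓝 x) (𝓝 (0 / (1 - 0))) :=
    hr0.div (hr0.const_sub 1) (by norm_num)
  rw [zero_div] at h1
  refine h1.congr fun y => ?_
  have h0 := ellDist_nonneg (P.exp 0) y.val x.val
  simp only [hr]
  field_simp
  ring

theorem continuous_val_apply (n : ℕ) : Continuous fun x : InterEll P => x.val n := by
  refine continuous_iff_continuousAt.2 fun x => ?_
  have hpos := P.pos 0
  have he : 0 < (if 1 ≤ P.exp 0 then 1 else 1 / P.exp 0) := by split_ifs <;> positivity
  have h := (tendsto_ellDist_zero x).rpow_const (Or.inr he.le)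
  rw [Real.zero_rpow he.ne'] at h
  refine tendsto_iff_dist_tendsto_zero.2 (squeeze_zero (fun _ => dist_nonneg) (fun y => ?_) h)
  exact abs_sub_le_ellDist_rpow hpos (summable_of_mem_interEll hpos (P.gt 0) y.mem x.mem) n

end InterEll

/-! ### Sequences that are constant on blocks -/

/-- With w = N^(-1/s), N w^s = 1 while N w^t = N^(-(t/s - 1)), which tends to 0 as N grows. -/
theorem exists_block {s t δ : ℝ} (hs : 0 < s) (hst : s < t) (hδ : 0 < δ) :
    ∃ (N : ℕ) (w : ℝ), 0 < w ∧ w ≤ 1 ∧ N * w ^ s = 1 ∧ N * w ^ t ≤ δ := by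
  have hts : 0 < t / s - 1 := by rw [sub_pos, one_lt_div hs]; exact hst
  have h1 := (tendsto_rpow_neg_atTop hts).comp (tendsto_natCast_atTop_atTop (R := ℝ))
  obtain ⟨N, hN, hN1⟩ := ((h1.eventually_le_const hδ).and (eventually_ge_atTop 1)).exists
  have hN0 : (0 : ℝ) < N := by exact_mod_cast hN1
  refine ⟨N, (N : ℝ) ^ (-(1 / s)), by positivity, ?_, ?_, ?_⟩
  · exact Real.rpow_le_one_of_one_le_of_nonpos (by exact_mod_cast hN1)
      (neg_nonpos.2 (by positivity))
  · rw [← Real.rpow_mul hN0.le, neg_mul, one_div_mul_cancel hs.ne', Real.rpow_neg_one,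
      mul_inv_cancel₀ hN0.ne']
  · rw [← Real.rpow_mul hN0.le]
    nth_rewrite 1 [← Real.rpow_one (N : ℝ)]
    rw [← Real.rpow_add hN0, show 1 + -(1 / s) * t = -(t / s - 1) by ring]
    exact hN

/-- Any positive block lengths are realized by a map from `ℕ`, so that sums over `ℕ` of functions
that are constant on blocks become weighted sums. -/
theorem exists_blockMap {J : Type*} [Countable J] [Infinite J] {N : J → ℕ} (hN : ∀ j, 0 < N j) :
    ∃ β : ℕ → J, ∀ g : J → ℝ, (∀ j, 0 ≤ g j) →
      ((Summable fun n => g (β n)) ↔ Summable fun j => N j * g j) := by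
  have : Infinite (Σ j, Fin (N j)) :=
    Infinite.of_surjective Sigma.fst fun j => ⟨⟨j, ⟨0, hN j⟩⟩, rfl⟩
  obtain ⟨e⟩ : Nonempty (ℕ ≃ Σ j, Fin (N j)) := nonempty_equiv_of_countable
  refine ⟨fun n => (e n).1, fun g hg => ?_⟩
  rw [← Function.comp_def (fun i : Σ j, Fin (N j) => g i.1) e, e.summable_iff,
    summable_sigma_of_nonneg fun i => hg i.1]
  simp [Summable.of_finite]

theorem exists_blockWeights {a b : ℝ} (ha : 0 ≤ a) (hab : a < b) :
    ∃ (β : ℕ → ℕ × ℕ) (W : ℕ → ℝ), (∀ n, 0 < W n) ∧ (∀ n, W n ≤ 1) ∧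
      (Summable fun n => W n ^ b) ∧ ∀ T : Set (ℕ × ℕ),
        (β ⁻¹' T).indicator W ∈ interEll a ↔ ∀ k, {m | (k, m) ∈ T}.Finite := by
  -- The choice r 0 = b makes every block small at exponent b.
  set r : ℕ → ℝ := fun k => a + (b - a) / ((k : ℝ) + 1) with hr
  have hba : 0 < b - a := sub_pos.2 hab
  have hra : ∀ k, a < r k := fun k => lt_add_of_pos_right _ (by positivity)
  have hr0 : ∀ k, 0 < r k := fun k => ha.trans_lt (hra k)
  have hrlt : ∀ k, r (k + 1) < r k := fun k => by
    simp only [hr]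
    push_cast
    gcongr
    linarith
  have hranti : Antitone r := antitone_nat_of_succ_le fun k => (hrlt k).le
  have hrb : ∀ k, r k ≤ b := fun k => (hranti (Nat.zero_le k)).trans_eq (by simp [hr])
  have hrlim : Tendsto r atTop (𝓝 a) := by
    have := (tendsto_one_div_add_atTop_nhds_zero_nat (𝕜 := ℝ)).const_mul (b - a)
    simpa [hr, div_eq_mul_inv] using this.const_add a
  set ε : ℕ × ℕ → ℝ := fun j => (1 / 2 : ℝ) ^ Encodable.encode j with hε
  have hεs : Summable ε := summable_geometric_two.comp_injective Encodable.encode_injective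
  have hex : ∀ j : ℕ × ℕ, ∃ (N : ℕ) (w : ℝ), 0 < w ∧ w ≤ 1 ∧ N * w ^ r (j.1 + 1) = 1 ∧
      N * w ^ r j.1 ≤ ε j := fun j => exists_block (hr0 _) (hrlt _) (by positivity)
  choose N w hw0 hw1 hws hwt using hex
  have hN : ∀ j, 0 < N j := fun j => Nat.pos_of_ne_zero fun h => by simpa [h] using hws j
  have hle : ∀ j p, r j.1 ≤ p → N j * w j ^ p ≤ ε j := fun j p hp =>
    (mul_le_mul_of_nonneg_left (Real.rpow_le_rpow_of_exponent_ge (hw0 j) (hw1 j) hp)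
      (Nat.cast_nonneg _)).trans (hwt j)
  obtain ⟨β, hβ⟩ := exists_blockMap hN
  refine ⟨β, fun n => w (β n), fun n => hw0 _, fun n => hw1 _, ?_, fun T => ?_⟩
  · rw [hβ (fun j => w j ^ b) fun j => (Real.rpow_pos_of_pos (hw0 j) _).le]
    refine Summable.of_nonneg_of_le (fun j => ?_) (fun j => hle j b (hrb _)) hεs
    have := hw0 j
    positivity
  have hsum : ∀ p, a < p → ((Summable fun n => |(β ⁻¹' T).indicator (fun n => w (β n)) n| ^ p) ↔
      Summable (T.indicator fun j => N j * w j ^ p)) := fun p hp => by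
    have hp0 : p ≠ 0 := (ha.trans_lt hp).ne'
    have h := hβ (T.indicator fun j => w j ^ p) fun j =>
      Set.indicator_nonneg (fun j _ => (Real.rpow_pos_of_pos (hw0 j) _).le) j
    convert h using 2
    · ext n
      by_cases hn : β n ∈ T
      · rw [Set.indicator_of_mem (by exact hn), Set.indicator_of_mem hn, abs_of_pos (hw0 _)]
      · rw [Set.indicator_of_notMem (by exact hn), Set.indicator_of_notMem hn, abs_zero,
          Real.zero_rpow hp0]
    · ext j
      by_cases hj : j ∈ T <;> simp [hj]
  rw [mem_interEll_iff ha]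
  constructor
  · intro h k
    have h1 := (hsum _ (hra (k + 1))).1 (h _ (hra (k + 1)))
    have h2 := h1.comp_injective (Prod.mk_right_injective k)
    have h3 := h2.tendsto_cofinite_zero.eventually_lt_const one_pos
    -- Each selected block of row k contributes exactly 1 at exponent `r (k + 1)`, whereas a
    -- summable family has only finitely many terms not below 1.
    refine (eventually_cofinite.1 h3).subset fun m hm => ?_
    have hm' : (k, m) ∈ T := hm
    simp [Function.comp, hm', hws]
  · intro h p hp
    rw [hsum p hp]
    obtain ⟨K, hK⟩ := (hrlim.eventually_le_const hp).exists
    -- The bound by ε can fail only at selected blocks of the rows before K, which are finite in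
    -- number.
    refine hεs.of_norm_bounded_eventually (((Set.finite_Iio K).biUnion fun k _ =>
      (h k).image (Prod.mk k)).subset fun j hj => ?_)
    by_cases hjT : j ∈ T
    · refine Set.mem_biUnion (x := j.1) ?_ ⟨j.2, hjT, rfl⟩
      by_contra hjK
      refine hj ?_
      rw [Set.mem_ofPred_eq, Set.indicator_of_mem hjT, Real.norm_of_nonneg]
      · exact hle j p ((hranti (not_lt.1 hjK)).trans hK)
      · have := hw0 j
        positivity
    · refine (hj ?_).elim
      rw [Set.mem_ofPred_eq, Set.indicator_of_notMem hjT, norm_zero]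
      positivity

/-! ### The reductions -/

theorem summable_abs_indicator_sub_rpow {W : ℕ → ℝ} (hW0 : ∀ n, 0 < W n) {q : ℝ} (hq : 0 < q)
    (hW : Summable fun n => W n ^ q) (S T : Set ℕ) :
    (∀ n, |S.indicator W n - T.indicator W n| ^ q ≤ W n ^ q) ∧
      Summable fun n => |S.indicator W n - T.indicator W n| ^ q := by
  have h : ∀ n, |S.indicator W n - T.indicator W n| ^ q ≤ W n ^ q := fun n => by
    refine Real.rpow_le_rpow (abs_nonneg _) ?_ hq.le
    have := (hW0 n).le
    by_cases hS : n ∈ S <;> by_cases hT : n ∈ T <;> simp [hS, hT, abs_of_nonneg, this]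
  exact ⟨h, Summable.of_nonneg_of_le (fun n => by positivity) h hW⟩

/-- If each coordinate is switched on and off by a clopen set, the indicator sequences vary
continuously in the sense of `ℓ^q`. -/
theorem tendsto_tsum_abs_indicator_sub_rpow {Z : Type v} [TopologicalSpace Z] {U : ℕ → Set Z}
    (hU : ∀ n, IsClopen (U n)) {W : ℕ → ℝ} (hW0 : ∀ n, 0 < W n) {q : ℝ} (hq : 0 < q)
    (hW : Summable fun n => W n ^ q) (z₀ : Z) :
    Tendsto (fun z => ∑' n, |{n | z ∈ U n}.indicator W n - {n | z₀ ∈ U n}.indicator W n| ^ q)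
      (𝓝 z₀) (𝓝 0) := by
  suffices h0 : Tendsto _ (𝓝 z₀) (𝓝 (∑' _ : ℕ, (0 : ℝ))) by rwa [tsum_zero] at h0
  refine tendsto_tsum_of_dominated_convergence hW (fun n => ?_)
    (Eventually.of_forall fun z n => ?_)
  -- As U n is clopen, coordinate n is constant near z₀.
  · have h : ∀ᶠ z in 𝓝 z₀, (z ∈ U n ↔ z₀ ∈ U n) := by
      by_cases hz : z₀ ∈ U n
      · filter_upwards [(hU n).isOpen.mem_nhds hz] with z hz' using iff_of_true hz' hz
      · filter_upwards [(hU n).compl.isOpen.mem_nhds hz] with z hz' using iff_of_false hz' hz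
    refine (tendsto_const_nhds (x := (0 : ℝ))).congr' ?_
    filter_upwards [h] with z hz
    have h1 : n ∈ {n | z ∈ U n} ↔ n ∈ {n | z₀ ∈ U n} := hz
    have h2 : {n | z ∈ U n}.indicator W n = {n | z₀ ∈ U n}.indicator W n := by
      by_cases h0 : n ∈ {n | z₀ ∈ U n}
      · rw [Set.indicator_of_mem h0, Set.indicator_of_mem (h1.2 h0)]
      · rw [Set.indicator_of_notMem h0, Set.indicator_of_notMem (mt h1.1 h0)]
    rw [h2, sub_self, abs_zero, Real.zero_rpow hq.ne']
  · rw [Real.norm_of_nonneg (by positivity)]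
    exact (summable_abs_indicator_sub_rpow hW0 hq hW _ _).1 n

/-- The reduction of finiteness conditions to membership in `⋂_{p > a} ℓ^p`, continuous in every
`ℓ^q` with `q ≥ b` simultaneously. -/
theorem exists_indicator_reduction {a b : ℝ} (ha : 0 ≤ a) (hab : a < b) (Z : Type v)
    [TopologicalSpace Z] (V : ℕ → ℕ → Set Z) (hV : ∀ k n, IsClopen (V k n)) :
    ∃ x : Z → ℕ → ℝ, (∀ z n, |x z n| ≤ 1) ∧
      (∀ q, b ≤ q → ∀ z z₀, Summable fun n => |x z n - x z₀ n| ^ q) ∧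
      (∀ q, b ≤ q → ∀ z, Summable fun n => |x z n| ^ q) ∧
      (∀ q, b ≤ q → ∀ z₀, Tendsto (fun z => ∑' n, |x z n - x z₀ n| ^ q) (𝓝 z₀) (𝓝 0)) ∧
      ∀ z, x z ∈ interEll a ↔ ∀ k, {n | z ∈ V k n}.Finite := by
  obtain ⟨β, W, hW0, hW1, hWb, hW⟩ := exists_blockWeights ha hab
  have hb : 0 < b := ha.trans_lt hab
  have hWq : ∀ q, b ≤ q → Summable fun n => W n ^ q := fun q hq =>
    Summable.of_nonneg_of_le (fun n => (Real.rpow_pos_of_pos (hW0 n) _).le)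
      (fun n => Real.rpow_le_rpow_of_exponent_ge (hW0 n) (hW1 n) hq) hWb
  refine ⟨fun z => {n | z ∈ V (β n).1 (β n).2}.indicator W, fun z n => ?_, fun q hq z z₀ => ?_,
    fun q hq z => ?_, fun q hq z₀ => ?_, fun z => hW {j | z ∈ V j.1 j.2}⟩
  · dsimp only
    rw [abs_of_nonneg (Set.indicator_nonneg (fun n _ => (hW0 n).le) n)]
    exact (Set.indicator_le_self' (fun n _ => (hW0 n).le) n).trans (hW1 n)
  · exact (summable_abs_indicator_sub_rpow hW0 (hb.trans_le hq) (hWq q hq) _ _).2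
  · simpa using (summable_abs_indicator_sub_rpow hW0 (hb.trans_le hq) (hWq q hq)
      {n | z ∈ V (β n).1 (β n).2} ∅).2
  · exact tendsto_tsum_abs_indicator_sub_rpow (fun n => hV _ _) hW0 (hb.trans_le hq) (hWq q hq) z₀

theorem reducesFiniteness_interEll {a b : ℝ} (ha : 0 ≤ a) (hab : a < b) (P : ExponentSeq b) :
    ReducesFiniteness.{0, v} {x : InterEll P | x.val ∈ interEll a} := by
  intro Z _ V hV
  obtain ⟨x, -, -, hs, hx, hxV⟩ := exists_indicator_reduction ha hab Z V hV
  have hb : 0 ≤ b := ha.trans hab.le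
  refine ⟨fun z => ⟨x z, (mem_interEll_iff hb).2 fun p hp => hs p hp.le z⟩, ?_, hxV⟩
  refine continuous_iff_continuousAt.2 fun z₀ => InterEll.tendsto_of_tendsto_ellDist fun i => ?_
  have he : 0 < (if 1 ≤ P.exp i then 1 / P.exp i else 1) := by
    have := P.pos i
    split_ifs <;> positivity
  have h := (hx (P.exp i) (P.gt i).le z₀).rpow_const (Or.inr he.le)
  rw [Real.zero_rpow he.ne'] at h
  simpa only [ellDist_eq_rpow] using h

/-- The supremum norm is dominated by the `ℓ^(a+1)` norm or quasi-norm, so the reduction with a + 1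
in the role of b serves both `c₀` and `ℓ^∞`. -/
theorem exists_continuous_ellInfty_reduction {a : ℝ} (ha : 0 ≤ a) (Z : Type v)
    [TopologicalSpace Z] (V : ℕ → ℕ → Set Z) (hV : ∀ k n, IsClopen (V k n)) :
    ∃ f : Z → EllInfty, Continuous f ∧ (∀ z, Tendsto (fun n => f z n) atTop (𝓝 0)) ∧
      ∀ z, (fun n => f z n) ∈ interEll a ↔ ∀ k, {n | z ∈ V k n}.Finite := by
  obtain ⟨x, h1, hd, hs, hx, hxV⟩ := exists_indicator_reduction ha (lt_add_one a) Z V hV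
  have hb : 0 < a + 1 := by positivity
  refine ⟨fun z => ⟨x z, memℓp_infty ⟨1, ?_⟩⟩, ?_, fun z => ?_, hxV⟩
  · rintro _ ⟨n, rfl⟩
    exact h1 z n
  · refine continuous_iff_continuousAt.2 fun z₀ => ?_
    have hlim := (hx (a + 1) le_rfl z₀).rpow_const (p := 1 / (a + 1)) (Or.inr (by positivity))
    rw [Real.zero_rpow (by positivity)] at hlim
    refine tendsto_iff_dist_tendsto_zero.2 (squeeze_zero (fun _ => dist_nonneg) (fun z => ?_) hlim)
    rw [dist_eq_norm]
    refine lp.norm_le_of_forall_le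
      (Real.rpow_nonneg (tsum_nonneg fun n => Real.rpow_nonneg (abs_nonneg _) _) _) fun n => ?_
    exact abs_sub_le_tsum_rpow hb (hd (a + 1) le_rfl z z₀) n
  · have h := (hs (a + 1) le_rfl z).tendsto_atTop_zero.rpow_const (p := 1 / (a + 1))
      (Or.inr (by positivity))
    rw [Real.zero_rpow (by positivity)] at h
    refine (tendsto_zero_iff_abs_tendsto_zero _).2 (h.congr fun n => ?_)
    rw [← Real.rpow_mul (abs_nonneg _), mul_one_div_cancel hb.ne', Real.rpow_one]
    rfl

theorem reducesFiniteness_ellInfty {a : ℝ} (ha : 0 ≤ a) :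
    ReducesFiniteness.{0, v} {x : EllInfty | (fun n => x n) ∈ interEll a} := by
  intro Z _ V hV
  obtain ⟨f, hf, -, hfV⟩ := exists_continuous_ellInfty_reduction ha Z V hV
  exact ⟨f, hf, hfV⟩

theorem reducesFiniteness_cZero {a : ℝ} (ha : 0 ≤ a) :
    ReducesFiniteness.{0, v} {x : CZero | (fun n => x.val n) ∈ interEll a} := by
  intro Z _ V hV
  obtain ⟨f, hf, hf0, hfV⟩ := exists_continuous_ellInfty_reduction ha Z V hV
  exact ⟨fun z => ⟨f z, hf0 z⟩, hf.subtype_mk hf0, hfV⟩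

theorem continuous_ellInfty_apply (n : ℕ) : Continuous fun x : EllInfty => x n :=
  (continuous_apply n).comp lp.uniformContinuous_coe.continuous

theorem corollary2 (a b : ℝ) (ha : 0 ≤ a) (hab : a < b) :
    (∀ P : ExponentSeq b,
      IsPiZeroComplete.{_, v} 3 {x : InterEll P | x.val ∈ interEll a} ∧
        ¬ IsFSigma {x : InterEll P | x.val ∈ interEll a} ∧
        ¬ IsGδ {x : InterEll P | x.val ∈ interEll a}) ∧
    (IsPiZeroComplete.{_, v} 3 {x : CZero | (fun n => x.val n) ∈ interEll a} ∧
      ¬ IsFSigma {x : CZero | (fun n => x.val n) ∈ interEll a} ∧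
      ¬ IsGδ {x : CZero | (fun n => x.val n) ∈ interEll a}) ∧
    (IsPiZeroComplete.{_, v} 3 {x : EllInfty | (fun n => x n) ∈ interEll a} ∧
      ¬ IsFSigma {x : EllInfty | (fun n => x n) ∈ interEll a} ∧
      ¬ IsGδ {x : EllInfty | (fun n => x n) ∈ interEll a}) := by
  refine ⟨fun P => ?_, ?_, ?_⟩
  · exact ⟨(reducesFiniteness_interEll ha hab P).isPiZeroComplete
      (isPiZero_three_preimage_interEll ha InterEll.continuous_val_apply),
      (reducesFiniteness_interEll ha hab P).not_isFSigma,
      (reducesFiniteness_interEll ha hab P).not_isGδ⟩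
  · exact ⟨(reducesFiniteness_cZero ha).isPiZeroComplete
      (isPiZero_three_preimage_interEll ha fun n =>
        (continuous_ellInfty_apply n).comp continuous_subtype_val),
      (reducesFiniteness_cZero ha).not_isFSigma, (reducesFiniteness_cZero ha).not_isGδ⟩
  · exact ⟨(reducesFiniteness_ellInfty ha).isPiZeroComplete
      (isPiZero_three_preimage_interEll ha continuous_ellInfty_apply),
      (reducesFiniteness_ellInfty ha).not_isFSigma, (reducesFiniteness_ellInfty ha).not_isGδ⟩
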